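/- There is an absolute constant $C>0$ such that the following holds. Let $m,B,k\ge 1$ and $d\ge 0$ be integers, let $A\in\mathbb{C}^{mB\times d}$ be a matrix with rows $a_1,\dots,a_{mB}$, and for $b\in\{1,\dots,m\}$ let $A_b\in\mathbb{C}^{B\times d}$ be the matrix with rows $a_{B(b-1)+1},\dots,a_{Bb}$. Put $\|x\|_X=\max_{1\le b\le m}\|A_bx\|_2$ for $x\in\mathbb{C}^d$, and let $T_s$ denote the set of vectors $x\in\mathbb{C}^d$ with at most $s$ non-zero entries and $\|x\|_2\le 1$. Suppose that there are a function $\ell$ and real numbers $Q_1,Q_2$ such that \[ \max_{1\le b\le m}\ \sup_{x\in T_s}\|A_bx\|_2\le \ell(s)\quad\text{and}\quad \ell(s)\le Q_1\sqrt{B}+Q_2\sqrt{s}\qquad\text{for all integers } 1\le s\le 2k, \] that all entries of $A$ have absolute value at most $1$, and that \[ B\ge\max\{Q_2^2\log^2 m,\ Q_1^2\log m\,\log k\}\qquad\text{and}\qquad k\ge Q_1^2\log^2 m . \] Then for every $u>0$, \[ \mathcal{N}\bigl(T_k/\sqrt{k},\,\|\cdot\|_X,\,u\bigr)\le (2d+1)^{C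 B/u^2}, \] where $\mathcal{N}(T,\|\cdot\|_X,u)$ is the least cardinality of a set $N\subseteq T$ such that every $x\in T$ has some $y\in N$ with $\|x-y\|_X\le u$. -/

import Mathlib

open scoped NNReal ENNReal

noncomputable section

/-- The set `T_k` of `k`-sparse vectors of `ℂ^d` with Euclidean norm at most `1`.
`hammingNorm` is the number of nonzero coordinates. -/
def sparseBall (d k : ℕ) : Set (EuclideanSpace ℂ (Fin d)) :=
  {x | hammingNorm (x.ofLp : Fin d → ℂ) ≤ k ∧ ‖x‖ ≤ 1}

/-- The scaled set `T_k / √k`. -/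
def scaledSparseBall (d k : ℕ) : Set (EuclideanSpace ℂ (Fin d)) :=
  (fun x => (Real.sqrt k)⁻¹ • x) '' sparseBall d k

/-- The `b`-th bucket `A_b` of an `mB × d` matrix `A`: the `B × d` matrix of the `B` consecutive
rows of `A` with (zero-based) indices `B * b + i`, `i < B`. -/
def bucket {m B d : ℕ} (A : Matrix (Fin (m * B)) (Fin d) ℂ) (b : Fin m) :
    Matrix (Fin B) (Fin d) ℂ :=
  Matrix.of fun i j => A (finProdFinEquiv (b, i)) j

/-- The seminorm `x ↦ ‖A_b x‖₂` on `ℂ^d`. -/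
def bucketSeminorm {m B d : ℕ} (A : Matrix (Fin (m * B)) (Fin d) ℂ) (b : Fin m) :
    Seminorm ℂ (EuclideanSpace ℂ (Fin d)) :=
  (normSeminorm ℂ (EuclideanSpace ℂ (Fin B))).comp (Matrix.toEuclideanLin (bucket A b))

/-- The norm `‖x‖_X = max_b ‖A_b x‖₂` (in general only a seminorm). -/
def xSeminorm {m B d : ℕ} (A : Matrix (Fin (m * B)) (Fin d) ℂ) :
    Seminorm ℂ (EuclideanSpace ℂ (Fin d)) :=
  Finset.univ.sup (bucketSeminorm A)

/-- `‖x‖_X` is the maximum over the buckets of `‖A_b x‖₂`. -/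
theorem xSeminorm_apply {m B d : ℕ} (A : Matrix (Fin (m * B)) (Fin d) ℂ)
    (x : EuclideanSpace ℂ (Fin d)) :
    xSeminorm A x = ⨆ b : Fin m, ‖Matrix.toEuclideanLin (bucket A b) x‖ := by
  apply le_antisymm
  · refine Seminorm.finset_sup_apply_le (Real.iSup_nonneg fun _ => norm_nonneg _) fun b _ => ?_
    exact le_ciSup (f := fun b : Fin m => ‖Matrix.toEuclideanLin (bucket A b) x‖)
      (Set.finite_range _).bddAbove b
  · refine Real.iSup_le (fun b => ?_) (apply_nonneg _ _)
    exact Seminorm.le_finset_sup_apply (p := bucketSeminorm A) (Finset.mem_univ b)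

/-- The covering number `N(T, p, u)`: the least cardinality of a `u`-net of `T`, that is, of a
subset of `T` such that every point of `T` is within `p`-distance at most `u` of it. -/
def seminormCoveringNumber {E : Type*} [AddCommGroup E] [Module ℂ E]
    (T : Set E) (p : Seminorm ℂ E) (u : ℝ≥0) : ℕ∞ :=
  letI : SeminormedAddCommGroup E := p.toAddGroupSeminorm.toSeminormedAddCommGroup
  Metric.coveringNumber u T

/-- The event that `max_b sup_{x ∈ T_s} ‖A_b x‖₂ ≤ ℓ(s)` for all `s ∈ {1, …, 2k}`. -/
def GoodBuckets {m B d : ℕ} (A : Matrix (Fin (m * B)) (Fin d) ℂ) (k : ℕ) (l : ℕ → ℝ) : Prop :=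
  ∀ s : ℕ, 1 ≤ s → s ≤ 2 * k → ∀ b : Fin m, ∀ x ∈ sparseBall d s,
    ‖Matrix.toEuclideanLin (bucket A b) x‖ ≤ l s

end

/-!
Maurey's empirical method, derandomised. The set `T_k / √k` lies in the `ℓ¹` ball, hence in the
convex hull of the origin and the `4d` vectors `2 iʳ e_j`. A point `x` of it is the mean of a
random atom, and `‖A_b (x - average of L atoms)‖` is of order `√(B / L)` for all `b` simultaneously,
so the averages of `L ≈ B / u²` atoms form a net. Only `(4d + 1)^L` such averages exist.

The union over the `m` buckets is paid for by the weak variance of the random atom. If `c_j` is the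
inner product of `A_b e_j` with a direction `S`, changing the phases of the coordinates of `x`
aligns all `x_j c_j`, so `∑ |x_j| |c_j| ≤ ‖S‖ sup_y ‖A_b y‖` over vectors `y` with the moduli of
`x`. These `y` stay in `T_k / √k`, where the hypotheses give `log m ‖A_b y‖ ≤ 2 √B`. With this
variance the potential `∑_b exp (c ‖partial sum‖)`, with a smoothed norm, grows slowly for some
choice of the next atom.
-/

section Bernstein

variable {ι β H : Type*} [NormedAddCommGroup H] {r : ℝ}

/-- The smoothed norm `√(r² + ‖x‖²)`, a differentiable majorant of the norm, used in the
exponential potential that selects the atoms. -/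
noncomputable def smoothNorm (r : ℝ) (x : H) : ℝ :=
  √(r ^ 2 + ‖x‖ ^ 2)

theorem sq_smoothNorm (r : ℝ) (x : H) : smoothNorm r x ^ 2 = r ^ 2 + ‖x‖ ^ 2 :=
  Real.sq_sqrt (by positivity)

theorem norm_le_smoothNorm (r : ℝ) (x : H) : ‖x‖ ≤ smoothNorm r x :=
  Real.le_sqrt_of_sq_le (le_add_of_nonneg_left (sq_nonneg r))

theorem le_smoothNorm (r : ℝ) (x : H) : r ≤ smoothNorm r x :=
  Real.le_sqrt_of_sq_le (le_add_of_nonneg_right (sq_nonneg ‖x‖))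

variable [InnerProductSpace ℝ H]

theorem smoothNorm_add_le (hr : 0 < r) (x y : H) :
    smoothNorm r (x + y) ≤
      smoothNorm r x + inner ℝ x y / smoothNorm r x + ‖y‖ ^ 2 / (2 * r) := by
  have hrx := le_smoothNorm r x
  have hx : 0 < smoothNorm r x := hr.trans_le hrx
  have hsq : smoothNorm r (x + y) ^ 2 = smoothNorm r x ^ 2 + 2 * inner ℝ x y + ‖y‖ ^ 2 := by
    rw [sq_smoothNorm, sq_smoothNorm, norm_add_sq_real]
    ring
  calc smoothNorm r (x + y)
      ≤ (smoothNorm r x ^ 2 + smoothNorm r (x + y) ^ 2) / (2 * smoothNorm r x) := by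
        rw [le_div_iff₀ (by positivity)]
        linarith [two_mul_le_add_sq (smoothNorm r x) (smoothNorm r (x + y))]
    _ = smoothNorm r x + inner ℝ x y / smoothNorm r x + ‖y‖ ^ 2 / (2 * smoothNorm r x) := by
        rw [hsq]
        field_simp
        ring
    _ ≤ _ := by gcongr

variable [Fintype ι] {p : ι → ℝ}

theorem sum_mul_exp_le_exp_sum_mul_sq (hp : p ∈ stdSimplex ℝ ι) {t : ι → ℝ}
    (hmean : ∑ j, p j * t j = 0) (ht : ∀ j, |t j| ≤ 1) :
    ∑ j, p j * Real.exp (t j) ≤ Real.exp (∑ j, p j * t j ^ 2) := by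
  have hexp (j : ι) : Real.exp (t j) ≤ 1 + t j + t j ^ 2 := by
    linarith [(abs_le.1 (Real.abs_exp_sub_one_sub_id_le (ht j))).2]
  calc ∑ j, p j * Real.exp (t j)
      ≤ ∑ j, p j * (1 + t j + t j ^ 2) :=
        Finset.sum_le_sum fun j _ => mul_le_mul_of_nonneg_left (hexp j) (hp.1 j)
    _ = ∑ j, p j * t j ^ 2 + 1 := by
        simp only [mul_add, mul_one, Finset.sum_add_distrib, hp.2, hmean]
        ring
    _ ≤ _ := Real.add_one_le_exp _

theorem exists_le_sum_mul_of_mem_stdSimplex (hp : p ∈ stdSimplex ℝ ι) (f : ι → ℝ) :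
    ∃ j, f j ≤ ∑ i, p i * f i := by
  obtain ⟨j, -, hj⟩ := (concaveOn_id convex_univ).exists_le_of_centerMass (t := Finset.univ)
    (fun j _ => hp.1 j) (by simp [hp.2]) (fun j _ => Set.mem_univ (f j))
  rw [Finset.centerMass_eq_of_sum_1 _ _ hp.2] at hj
  exact ⟨j, hj⟩

/-- The random vector with value `v j` in probability `p j` meets the conditions of Bernstein's
inequality: it is centred, bounded by `M`, and has variance at most `V` in each direction. That `p`
is a probability vector is not part of the structure, since `p` is shared by several `v`. -/
structure IsBernsteinVector (p : ι → ℝ) (v : ι → H) (M V : ℝ) : Prop where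
  sum_smul_eq_zero : ∑ j, p j • v j = 0
  norm_le : ∀ j, ‖v j‖ ≤ M
  sum_mul_inner_sq_le : ∀ x : H, ∑ j, p j * inner ℝ x (v j) ^ 2 ≤ V * ‖x‖ ^ 2

namespace IsBernsteinVector

variable {M V c : ℝ}

theorem sum_mul_exp_inner_le {v : ι → H} (hv : IsBernsteinVector p v M V)
    (hp : p ∈ stdSimplex ℝ ι) {y : H} (hy : ‖y‖ * M ≤ 1) :
    ∑ j, p j * Real.exp (inner ℝ y (v j)) ≤ Real.exp (V * ‖y‖ ^ 2) := by
  have hmean : ∑ j, p j * inner ℝ y (v j) = 0 := by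
    simp only [← real_inner_smul_right, ← inner_sum, hv.sum_smul_eq_zero, inner_zero_right]
  have hbound (j : ι) : |inner ℝ y (v j)| ≤ 1 :=
    calc |inner ℝ y (v j)| ≤ ‖y‖ * ‖v j‖ := abs_real_inner_le_norm _ _
      _ ≤ ‖y‖ * M := by
        gcongr
        exact hv.norm_le j
      _ ≤ 1 := hy
  exact (sum_mul_exp_le_exp_sum_mul_sq hp hmean hbound).trans
    (Real.exp_le_exp.2 (hv.sum_mul_inner_sq_le y))

theorem sum_mul_exp_smoothNorm_add_le {v : ι → H} (hv : IsBernsteinVector p v M V)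
    (hp : p ∈ stdSimplex ℝ ι) (hV : 0 ≤ V) (hr : 0 < r) (hc : 0 ≤ c) (hcM : c * M ≤ 1) (x : H) :
    ∑ j, p j * Real.exp (c * smoothNorm r (x + v j)) ≤
      Real.exp (c * smoothNorm r x + (c * (M ^ 2 / (2 * r)) + c ^ 2 * V)) := by
  set a := smoothNorm r x
  have ha : 0 < a := hr.trans_le (le_smoothNorm r x)
  have hM : 0 ≤ M := by
    obtain ⟨j, -⟩ := exists_le_sum_mul_of_mem_stdSimplex hp 0
    exact (norm_nonneg _).trans (hv.norm_le j)
  have hy : ‖(c / a) • x‖ ≤ c := by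
    rw [norm_smul, Real.norm_of_nonneg (by positivity), div_mul_eq_mul_div]
    exact div_le_of_le_mul₀ ha.le hc (mul_le_mul_of_nonneg_left (norm_le_smoothNorm r x) hc)
  have hstep (j : ι) : c * smoothNorm r (x + v j) ≤
      c * a + c * (M ^ 2 / (2 * r)) + inner ℝ ((c / a) • x) (v j) :=
    calc c * smoothNorm r (x + v j)
        ≤ c * (a + inner ℝ x (v j) / a + M ^ 2 / (2 * r)) := by
          refine mul_le_mul_of_nonneg_left ((smoothNorm_add_le hr x (v j)).trans ?_) hc
          gcongr
          exact hv.norm_le j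
      _ = _ := by
          rw [real_inner_smul_left]
          ring
  calc ∑ j, p j * Real.exp (c * smoothNorm r (x + v j))
      ≤ ∑ j, p j * Real.exp (c * a + c * (M ^ 2 / (2 * r)) + inner ℝ ((c / a) • x) (v j)) :=
        Finset.sum_le_sum fun j _ =>
          mul_le_mul_of_nonneg_left (Real.exp_le_exp.2 (hstep j)) (hp.1 j)
    _ = Real.exp (c * a + c * (M ^ 2 / (2 * r))) *
          ∑ j, p j * Real.exp (inner ℝ ((c / a) • x) (v j)) := by
        simp only [Real.exp_add _ (inner ℝ _ _), Finset.mul_sum, mul_left_comm]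
    _ ≤ Real.exp (c * a + c * (M ^ 2 / (2 * r))) * Real.exp (V * ‖(c / a) • x‖ ^ 2) := by
        gcongr
        exact hv.sum_mul_exp_inner_le hp ((mul_le_mul_of_nonneg_right hy hM).trans hcM)
    _ ≤ Real.exp (c * a + c * (M ^ 2 / (2 * r))) * Real.exp (V * c ^ 2) := by gcongr
    _ = _ := by rw [← Real.exp_add, add_assoc, mul_comm V]

variable [Fintype β] {v : β → ι → H}

theorem exists_sum_exp_smoothNorm_sum_le (hv : ∀ b, IsBernsteinVector p (v b) M V)
    (hp : p ∈ stdSimplex ℝ ι) (hV : 0 ≤ V) (hr : 0 < r) (hc : 0 ≤ c) (hcM : c * M ≤ 1) (L : ℕ) :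
    ∃ z : Fin L → ι, ∑ b, Real.exp (c * smoothNorm r (∑ i, v b (z i))) ≤
      Fintype.card β * Real.exp (c * r + L * (c * (M ^ 2 / (2 * r)) + c ^ 2 * V)) := by
  set δ := c * (M ^ 2 / (2 * r)) + c ^ 2 * V
  induction L with
  | zero => exact ⟨Fin.elim0, by simp [smoothNorm, Real.sqrt_sq hr.le]⟩
  | succ L ih =>
    obtain ⟨z, hz⟩ := ih
    obtain ⟨j, hj⟩ := exists_le_sum_mul_of_mem_stdSimplex hp fun j =>
      ∑ b, Real.exp (c * smoothNorm r (∑ i, v b (z i) + v b j))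
    refine ⟨Fin.snoc z j, ?_⟩
    simp only [Fin.sum_univ_castSucc, Fin.snoc_castSucc, Fin.snoc_last]
    calc ∑ b, Real.exp (c * smoothNorm r (∑ i, v b (z i) + v b j))
        ≤ ∑ b, ∑ j, p j * Real.exp (c * smoothNorm r (∑ i, v b (z i) + v b j)) := by
          rw [Finset.sum_comm]
          simpa only [Finset.mul_sum] using hj
      _ ≤ ∑ b, Real.exp (c * smoothNorm r (∑ i, v b (z i)) + δ) :=
          Finset.sum_le_sum fun b _ =>
            (hv b).sum_mul_exp_smoothNorm_add_le hp hV hr hc hcM _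
      _ = (∑ b, Real.exp (c * smoothNorm r (∑ i, v b (z i)))) * Real.exp δ := by
          simp only [Real.exp_add, Finset.sum_mul]
      _ ≤ Fintype.card β * Real.exp (c * r + L * δ) * Real.exp δ := by gcongr
      _ = _ := by
          rw [mul_assoc, ← Real.exp_add]
          push_cast
          ring_nf

theorem exists_norm_sum_le (hv : ∀ b, IsBernsteinVector p (v b) M V)
    (hp : p ∈ stdSimplex ℝ ι) (hV : 0 ≤ V) (hr : 0 < r) (hc : 0 < c) (hcM : c * M ≤ 1) (L : ℕ) :
    ∃ z : Fin L → ι, ∀ b, ‖∑ i, v b (z i)‖ ≤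
      Real.log (Fintype.card β) / c + r + L * (M ^ 2 / (2 * r) + c * V) := by
  obtain ⟨z, hz⟩ := exists_sum_exp_smoothNorm_sum_le hv hp hV hr hc.le hcM L
  refine ⟨z, fun b => ?_⟩
  have hβ : (0 : ℝ) < Fintype.card β := mod_cast Fintype.card_pos_iff.2 ⟨b⟩
  have hexp : Real.exp (c * ‖∑ i, v b (z i)‖) ≤ Real.exp (Real.log (Fintype.card β) +
      (c * r + L * (c * (M ^ 2 / (2 * r)) + c ^ 2 * V))) := by
    rw [Real.exp_add, Real.exp_log hβ]
    calc Real.exp (c * ‖∑ i, v b (z i)‖)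
        ≤ Real.exp (c * smoothNorm r (∑ i, v b (z i))) := by
          gcongr
          exact norm_le_smoothNorm r _
      _ ≤ ∑ b, Real.exp (c * smoothNorm r (∑ i, v b (z i))) :=
          Finset.single_le_sum (f := fun b => Real.exp (c * smoothNorm r (∑ i, v b (z i))))
            (fun _ _ => (Real.exp_pos _).le) (Finset.mem_univ b)
      _ ≤ _ := hz
  refine le_of_mul_le_mul_left ((Real.exp_le_exp.1 hexp).trans_eq ?_) hc
  field_simp
  ring

end IsBernsteinVector

theorem sum_mul_sub_sq_le {f : ι → ℝ} {μ : ℝ} (hp : ∑ j, p j = 1) (hμ : ∑ j, p j * f j = μ) :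
    ∑ j, p j * (f j - μ) ^ 2 ≤ ∑ j, p j * f j ^ 2 := by
  have hexpand : ∑ j, p j * (f j - μ) ^ 2 =
      ∑ j, p j * f j ^ 2 - 2 * μ * ∑ j, p j * f j + μ ^ 2 * ∑ j, p j := by
    simp only [Finset.mul_sum, ← Finset.sum_sub_distrib, ← Finset.sum_add_distrib]
    exact Finset.sum_congr rfl fun j _ => by ring
  rw [hexpand, hμ, hp]
  linarith [sq_nonneg μ]

theorem isBernsteinVector_sub {v : ι → H} {μ : H} {M V : ℝ} (hp : ∑ j, p j = 1)
    (hμ : ∑ j, p j • v j = μ) (hM : ∀ j, ‖v j - μ‖ ≤ M)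
    (hV : ∀ x : H, ∑ j, p j * inner ℝ x (v j) ^ 2 ≤ V * ‖x‖ ^ 2) :
    IsBernsteinVector p (fun j => v j - μ) M V where
  sum_smul_eq_zero := by
    simp only [smul_sub, Finset.sum_sub_distrib, ← Finset.sum_smul, hp, hμ, one_smul, sub_self]
  norm_le := hM
  sum_mul_inner_sq_le x := by
    have hmean : ∑ j, p j * inner ℝ x (v j) = inner ℝ x μ := by
      simp only [← hμ, inner_sum, real_inner_smul_right]
    simp only [inner_sub_right]
    exact (sum_mul_sub_sq_le hp hmean).trans (hV x)

end Bernstein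

section Atoms

open Complex (I)

attribute [local instance] InnerProductSpace.complexToReal

/-- Coefficients of `z` in a positive combination of `1, i, -1, -i`, halved so that their sum does
not exceed `‖z‖`. -/
noncomputable def phaseWeight (z : ℂ) : Fin 4 → ℝ :=
  ![z.re⁺ / 2, z.im⁺ / 2, z.re⁻ / 2, z.im⁻ / 2]

theorem phaseWeight_nonneg (z : ℂ) (r : Fin 4) : 0 ≤ phaseWeight z r := by
  fin_cases r <;> simp [phaseWeight, posPart_nonneg, negPart_nonneg, div_nonneg]

theorem sum_phaseWeight_le (z : ℂ) : ∑ r, phaseWeight z r ≤ ‖z‖ := by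
  calc ∑ r, phaseWeight z r = ((z.re⁺ + z.re⁻) + (z.im⁺ + z.im⁻)) / 2 := by
        simp only [Fin.sum_univ_four, phaseWeight, Matrix.cons_val]
        ring
    _ = (|z.re| + |z.im|) / 2 := by rw [posPart_add_negPart, posPart_add_negPart]
    _ ≤ ‖z‖ := by linarith [Complex.abs_re_le_norm z, Complex.abs_im_le_norm z]

theorem sum_phaseWeight_mul (z : ℂ) :
    ∑ r, (phaseWeight z r : ℂ) * (2 * I ^ (r : ℕ)) = z := by
  calc ∑ r, (phaseWeight z r : ℂ) * (2 * I ^ (r : ℕ))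
      = ((z.re⁺ - z.re⁻ : ℝ) : ℂ) + ((z.im⁺ - z.im⁻ : ℝ) : ℂ) * I := by
        simp only [Fin.sum_univ_four, phaseWeight, Matrix.cons_val, Fin.coe_ofNat_eq_mod,
          Nat.reduceMod, pow_zero, pow_one, Complex.I_sq, Complex.I_pow_three]
        push_cast
        ring
    _ = z := by rw [posPart_sub_negPart, posPart_sub_negPart, Complex.re_add_im]

variable {ι : Type*}

/-- The origin and the vectors `2 iʳ e_j`; their convex hull contains the `ℓ¹` unit ball. -/
noncomputable def l1Atom [DecidableEq ι] : Option (ι × Fin 4) → EuclideanSpace ℂ ι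
  | none => 0
  | some (j, r) => (2 * I ^ (r : ℕ)) • EuclideanSpace.single j 1

variable {E : Type*} [NormedAddCommGroup E] [NormedSpace ℂ E] {R : ℝ}

theorem norm_map_l1Atom_le [DecidableEq ι] {F : EuclideanSpace ℂ ι →ₗ[ℂ] E} (hR : 0 ≤ R)
    (hF : ∀ j, ‖F (EuclideanSpace.single j 1)‖ ≤ R) (a : Option (ι × Fin 4)) :
    ‖F (l1Atom a)‖ ≤ 2 * R := by
  rcases a with _ | ⟨j, r⟩
  · simpa [l1Atom] using hR
  · simpa [l1Atom, norm_smul] using hF j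

variable [Fintype ι]

/-- The weights that represent `x` as a convex combination of the vectors `l1Atom a`; the origin
takes the remaining mass. -/
noncomputable def l1AtomWeight (x : EuclideanSpace ℂ ι) : Option (ι × Fin 4) → ℝ
  | none => 1 - ∑ j, ∑ r, phaseWeight (x j) r
  | some (j, r) => phaseWeight (x j) r

theorem l1AtomWeight_mem_stdSimplex {x : EuclideanSpace ℂ ι} (hx : ∑ j, ‖x j‖ ≤ 1) :
    l1AtomWeight x ∈ stdSimplex ℝ (Option (ι × Fin 4)) := by
  refine ⟨?_, ?_⟩
  · rintro (_ | ⟨j, r⟩)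
    · exact sub_nonneg.2 ((Finset.sum_le_sum fun j _ => sum_phaseWeight_le (x j)).trans hx)
    · exact phaseWeight_nonneg _ _
  · simp only [Fintype.sum_option, Fintype.sum_prod_type, l1AtomWeight, sub_add_cancel]

variable [DecidableEq ι]

theorem sum_l1AtomWeight_smul_l1Atom (x : EuclideanSpace ℂ ι) :
    ∑ a, l1AtomWeight x a • l1Atom a = x := by
  simp only [Fintype.sum_option, Fintype.sum_prod_type, l1AtomWeight, l1Atom, smul_zero, zero_add]
  calc ∑ j, ∑ r, phaseWeight (x j) r • (2 * I ^ (r : ℕ)) • EuclideanSpace.single j (1 : ℂ)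
      = ∑ j, x j • EuclideanSpace.single j (1 : ℂ) := by
        simp only [← smul_assoc, ← Finset.sum_smul, Complex.real_smul, sum_phaseWeight_mul]
    _ = x := by simpa using (EuclideanSpace.basisFun ι ℂ).sum_repr x

theorem map_eq_sum_smul_map_single (F : EuclideanSpace ℂ ι →ₗ[ℂ] E) (x : EuclideanSpace ℂ ι) :
    F x = ∑ j, x j • F (EuclideanSpace.single j 1) := by
  conv_lhs => rw [← (EuclideanSpace.basisFun ι ℂ).sum_repr x]
  simp

theorem norm_map_le_mul_sum_norm {F : EuclideanSpace ℂ ι →ₗ[ℂ] E}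
    (hF : ∀ j, ‖F (EuclideanSpace.single j 1)‖ ≤ R)
    (x : EuclideanSpace ℂ ι) : ‖F x‖ ≤ R * ∑ j, ‖x j‖ := by
  rw [map_eq_sum_smul_map_single, Finset.mul_sum]
  refine norm_sum_le_of_le _ fun j _ => ?_
  rw [norm_smul, mul_comm]
  gcongr
  exact hF j

variable {H : Type*} [NormedAddCommGroup H] [InnerProductSpace ℂ H]
  {W : EuclideanSpace ℂ ι →ₗ[ℂ] H} {x : EuclideanSpace ℂ ι}

theorem sum_norm_mul_norm_inner_le {τ : ℝ}
    (hτ : ∀ y : EuclideanSpace ℂ ι, (∀ j, ‖y j‖ = ‖x j‖) → ‖W y‖ ≤ τ) (S : H) :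
    ∑ j, ‖x j‖ * ‖inner ℂ S (W (EuclideanSpace.single j 1))‖ ≤ ‖S‖ * τ := by
  choose ω hω hωc using fun j =>
    RCLike.exists_norm_eq_mul_self (inner ℂ S (W (EuclideanSpace.single j 1)))
  let y : EuclideanSpace ℂ ι := WithLp.toLp 2 fun j => ‖x j‖ * ω j
  have hy (j : ι) : ‖y j‖ = ‖x j‖ := by simp [y, hω]
  have haligned : inner ℂ S (W y) =
      ((∑ j, ‖x j‖ * ‖inner ℂ S (W (EuclideanSpace.single j 1))‖ : ℝ) : ℂ) := by
    rw [map_eq_sum_smul_map_single, inner_sum]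
    push_cast
    refine Finset.sum_congr rfl fun j _ => ?_
    rw [inner_smul_right, mul_assoc, ← hωc j]
    rfl
  calc ∑ j, ‖x j‖ * ‖inner ℂ S (W (EuclideanSpace.single j 1))‖
      ≤ ‖(inner ℂ S (W y) : ℂ)‖ := by
        rw [haligned, Complex.norm_real]
        exact Real.le_norm_self _
    _ ≤ ‖S‖ * ‖W y‖ := norm_inner_le_norm _ _
    _ ≤ ‖S‖ * τ := by gcongr; exact hτ y hy

theorem sum_norm_mul_norm_inner_sq_le {τ : ℝ} (hR : 0 ≤ R)
    (hW : ∀ j, ‖W (EuclideanSpace.single j 1)‖ ≤ R)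
    (hτ : ∀ y : EuclideanSpace ℂ ι, (∀ j, ‖y j‖ = ‖x j‖) → ‖W y‖ ≤ τ) (S : H) :
    ∑ j, ‖x j‖ * ‖inner ℂ S (W (EuclideanSpace.single j 1))‖ ^ 2 ≤ R * τ * ‖S‖ ^ 2 := by
  have hinner (j : ι) : ‖inner ℂ S (W (EuclideanSpace.single j 1))‖ ≤ ‖S‖ * R :=
    (norm_inner_le_norm _ _).trans (by gcongr; exact hW j)
  calc ∑ j, ‖x j‖ * ‖inner ℂ S (W (EuclideanSpace.single j 1))‖ ^ 2
      ≤ ∑ j, ‖S‖ * R * (‖x j‖ * ‖inner ℂ S (W (EuclideanSpace.single j 1))‖) := by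
        refine Finset.sum_le_sum fun j _ => ?_
        rw [sq, ← mul_assoc, mul_comm (‖S‖ * R)]
        gcongr
        exact hinner j
    _ ≤ ‖S‖ * R * (‖S‖ * τ) := by
        rw [← Finset.mul_sum]
        gcongr
        exact sum_norm_mul_norm_inner_le hτ S
    _ = _ := by ring

theorem sum_l1AtomWeight_mul_inner_sq_le {τ : ℝ} (hR : 0 ≤ R)
    (hW : ∀ j, ‖W (EuclideanSpace.single j 1)‖ ≤ R)
    (hτ : ∀ y : EuclideanSpace ℂ ι, (∀ j, ‖y j‖ = ‖x j‖) → ‖W y‖ ≤ τ) (S : H) :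
    ∑ a, l1AtomWeight x a * inner ℝ S (W (l1Atom a)) ^ 2 ≤ 4 * R * τ * ‖S‖ ^ 2 := by
  have hatom (j : ι) (r : Fin 4) : inner ℝ S (W (l1Atom (some (j, r)))) ^ 2 ≤
      4 * ‖inner ℂ S (W (EuclideanSpace.single j 1))‖ ^ 2 := by
    have hre : |inner ℝ S (W (l1Atom (some (j, r))))| ≤
        2 * ‖inner ℂ S (W (EuclideanSpace.single j 1))‖ := by
      rw [real_inner_eq_re_inner ℂ, RCLike.re_eq_complex_re]
      refine (Complex.abs_re_le_norm _).trans_eq ?_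
      simp [l1Atom, inner_smul_right]
    calc inner ℝ S (W (l1Atom (some (j, r)))) ^ 2
        ≤ (2 * ‖inner ℂ S (W (EuclideanSpace.single j 1))‖) ^ 2 :=
          sq_le_sq' (abs_le.1 hre).1 (abs_le.1 hre).2
      _ = _ := by ring
  calc ∑ a, l1AtomWeight x a * inner ℝ S (W (l1Atom a)) ^ 2
      = ∑ j, ∑ r, phaseWeight (x j) r * inner ℝ S (W (l1Atom (some (j, r)))) ^ 2 := by
        have hnone : l1Atom (none : Option (ι × Fin 4)) = 0 := rfl
        simp only [Fintype.sum_option, Fintype.sum_prod_type, l1AtomWeight, hnone, map_zero,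
          inner_zero_right, zero_pow two_ne_zero, mul_zero, zero_add]
    _ ≤ ∑ j, ∑ r, phaseWeight (x j) r *
          (4 * ‖inner ℂ S (W (EuclideanSpace.single j 1))‖ ^ 2) := by
        gcongr with j _ r _
        · exact phaseWeight_nonneg _ _
        · exact hatom j r
    _ ≤ ∑ j, ‖x j‖ * (4 * ‖inner ℂ S (W (EuclideanSpace.single j 1))‖ ^ 2) := by
        simp only [← Finset.sum_mul]
        gcongr with j _
        exact sum_phaseWeight_le _
    _ = 4 * ∑ j, ‖x j‖ * ‖inner ℂ S (W (EuclideanSpace.single j 1))‖ ^ 2 := by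
        simp only [Finset.mul_sum, mul_left_comm]
    _ ≤ 4 * (R * τ * ‖S‖ ^ 2) := by
        gcongr
        exact sum_norm_mul_norm_inner_sq_le hR hW hτ S
    _ = _ := by ring

theorem isBernsteinVector_map_l1Atom_sub {τ : ℝ} (hR : 0 ≤ R)
    (hW : ∀ j, ‖W (EuclideanSpace.single j 1)‖ ≤ R) (hx : ∑ j, ‖x j‖ ≤ 1)
    (hτ : ∀ y : EuclideanSpace ℂ ι, (∀ j, ‖y j‖ = ‖x j‖) → ‖W y‖ ≤ τ) :
    IsBernsteinVector (l1AtomWeight x) (fun a => W (l1Atom a) - W x) (3 * R) (4 * R * τ) := by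
  have hmean : ∑ a, l1AtomWeight x a • W (l1Atom a) = W x := by
    conv_rhs => rw [← sum_l1AtomWeight_smul_l1Atom x]
    simp only [map_sum, W.map_smul_of_tower]
  refine isBernsteinVector_sub (l1AtomWeight_mem_stdSimplex hx).2 hmean (fun a => ?_)
    (sum_l1AtomWeight_mul_inner_sq_le hR hW hτ)
  calc ‖W (l1Atom a) - W x‖
      ≤ ‖W (l1Atom a)‖ + ‖W x‖ := norm_sub_le _ _
    _ ≤ 2 * R + R * 1 := by
        gcongr
        · exact norm_map_l1Atom_le hR hW a
        · exact (norm_map_le_mul_sum_norm hW x).trans (by gcongr)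
    _ = 3 * R := by ring

variable {β : Type*} [Fintype β] {V : β → EuclideanSpace ℂ ι →ₗ[ℂ] H} {Λ : ℝ}

theorem exists_norm_map_sub_average_le (hR : 0 < R)
    (hV : ∀ b j, ‖V b (EuclideanSpace.single j 1)‖ ≤ R) (hΛ : 0 < Λ)
    (hβ : Real.log (Fintype.card β) ≤ Λ) (hx : ∑ j, ‖x j‖ ≤ 1)
    (hweak : ∀ b, ∀ y : EuclideanSpace ℂ ι, (∀ j, ‖y j‖ = ‖x j‖) → Λ * ‖V b y‖ ≤ 2 * R)
    {L : ℕ} (hL : Λ ^ 2 ≤ L) :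
    ∃ z : Fin L → Option (ι × Fin 4), ∀ b,
      ‖V b (x - (L : ℝ)⁻¹ • ∑ i, l1Atom (z i))‖ ≤ 11 * R / √L := by
  have hL0 : (0 : ℝ) < L := (sq_pos_of_pos hΛ).trans_le hL
  set q := √(L : ℝ)
  have hq : 0 < q := Real.sqrt_pos.2 hL0
  have hqL : (L : ℝ) = q ^ 2 := (Real.sq_sqrt hL0.le).symm
  have hΛq : Λ ≤ q := Real.le_sqrt_of_sq_le hL
  have hbern (b : β) := isBernsteinVector_map_l1Atom_sub (τ := 2 * R / Λ) hR.le (hV b) hx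
    fun y hy => by rw [le_div_iff₀' hΛ]; exact hweak b y hy
  obtain ⟨z, hz⟩ := IsBernsteinVector.exists_norm_sum_le (r := 3 * R * q) (c := Λ / (3 * R * q))
    hbern (l1AtomWeight_mem_stdSimplex hx) (by positivity) (by positivity) (by positivity)
    (by rw [div_mul_eq_mul_div, div_le_one (by positivity), mul_comm]; gcongr) L
  refine ⟨z, fun b => ?_⟩
  have hsum : ‖∑ i, (V b (l1Atom (z i)) - V b x)‖ ≤ 11 * R * q := by
    have hlog : Real.log (Fintype.card β) / (Λ / (3 * R * q)) ≤ 3 * R * q := by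
      rw [div_div_eq_mul_div, div_le_iff₀ hΛ, mul_comm]
      gcongr
    have hdrift : (L : ℝ) * ((3 * R) ^ 2 / (2 * (3 * R * q)) +
        Λ / (3 * R * q) * (4 * R * (2 * R / Λ))) = 25 / 6 * (R * q) := by
      rw [hqL]
      field_simp
      ring
    linarith [hz b, mul_pos hR hq]
  have haverage : V b (x - (L : ℝ)⁻¹ • ∑ i, l1Atom (z i)) =
      -((L : ℝ)⁻¹ • ∑ i, (V b (l1Atom (z i)) - V b x)) := by
    simp only [map_sub, (V b).map_smul_of_tower, map_sum, Finset.sum_sub_distrib, smul_sub,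
      Finset.sum_const, Finset.card_univ, Fintype.card_fin]
    rw [← Nat.cast_smul_eq_nsmul ℝ, inv_smul_smul₀ hL0.ne', neg_sub]
  rw [haverage, norm_neg, norm_smul, norm_inv, Real.norm_of_nonneg hL0.le, hqL]
  calc (q ^ 2)⁻¹ * ‖∑ i, (V b (l1Atom (z i)) - V b x)‖
      ≤ (q ^ 2)⁻¹ * (11 * R * q) := by gcongr
    _ = 11 * R / q := by field_simp

end Atoms

section CoveringNumber

theorem seminormCoveringNumber_le_card {E ι : Type*} [AddCommGroup E] [Module ℂ E] [Fintype ι]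
    {T : Set E} {p : Seminorm ℂ E} {u : ℝ≥0} (f : ι → E)
    (hf : ∀ x ∈ T, ∃ i, p (x - f i) ≤ u / 2) :
    seminormCoveringNumber T p u ≤ Fintype.card ι := by
  let : SeminormedAddCommGroup E := p.toAddGroupSeminorm.toSeminormedAddCommGroup
  have hcover : Metric.IsCover (u / 2) T (Set.range f) := by
    intro x hx
    obtain ⟨i, hi⟩ := hf x hx
    refine ⟨f i, Set.mem_range_self i, ?_⟩
    change edist x (f i) ≤ ((u / 2 : ℝ≥0) : ℝ≥0∞)
    rw [edist_nndist, ENNReal.coe_le_coe, ← NNReal.coe_le_coe, coe_nndist, dist_eq_norm]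
    exact hi
  calc Metric.coveringNumber u T
      = Metric.coveringNumber (2 * (u / 2)) T := by rw [mul_div_cancel₀ u two_ne_zero]
    _ ≤ Metric.externalCoveringNumber (u / 2) T :=
        Metric.coveringNumber_two_mul_le_externalCoveringNumber _ _
    _ ≤ (Set.range f).encard := hcover.externalCoveringNumber_le_encard
    _ ≤ (Set.univ : Set ι).encard := by
        rw [← Set.image_univ]
        exact Set.encard_image_le f _
    _ = Fintype.card ι := by simp

variable {ι β H : Type*} [Fintype ι] [DecidableEq ι] [Fintype β] [NormedAddCommGroup H]
  [InnerProductSpace ℂ H] {W : β → EuclideanSpace ℂ ι →ₗ[ℂ] H} {T : Set (EuclideanSpace ℂ ι)}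
  {R : ℝ}

theorem exists_forall_mem_norm_map_sub_average_le (hR : 0 ≤ R)
    (hW : ∀ b j, ‖W b (EuclideanSpace.single j 1)‖ ≤ R) (hT : ∀ x ∈ T, ∑ j, ‖x j‖ ≤ 1)
    (hTphase : ∀ x ∈ T, ∀ y : EuclideanSpace ℂ ι, (∀ j, ‖y j‖ = ‖x j‖) → y ∈ T)
    (hlog : ∀ b, ∀ x ∈ T, Real.log (Fintype.card β) * ‖W b x‖ ≤ 2 * R) {u : ℝ} (hu : 0 < u) :
    ∃ L : ℕ, L ≤ 500 * (R / u) ^ 2 ∧ ∀ x ∈ T, ∃ z : Fin L → Option (ι × Fin 4), ∀ b,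
      ‖W b (x - (L : ℝ)⁻¹ • ∑ i, l1Atom (z i))‖ ≤ u / 2 := by
  set Λ := max 1 (Real.log (Fintype.card β))
  have hΛ : 1 ≤ Λ := le_max_left _ _
  have hweak (b : β) (x : EuclideanSpace ℂ ι) (hx : x ∈ T) : Λ * ‖W b x‖ ≤ 2 * R := by
    rw [max_mul_of_nonneg _ _ (norm_nonneg _)]
    refine max_le ?_ (hlog b x hx)
    rw [one_mul, two_mul]
    exact (norm_map_le_mul_sum_norm (hW b) x).trans
      ((mul_le_of_le_one_right hR (hT x hx)).trans (le_add_of_nonneg_right hR))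
  rcases le_or_gt (4 * R) (Λ * u) with hsmall | hlarge
  · refine ⟨0, by simpa using by positivity, fun x hx => ⟨Fin.elim0, fun b => ?_⟩⟩
    have hle : Λ * ‖W b x‖ ≤ Λ * (u / 2) := (hweak b x hx).trans (by linarith)
    simpa using le_of_mul_le_mul_left hle (by linarith)
  · have hR' : 0 < R := by nlinarith
    set t := R / u
    have hΛt : Λ ≤ 4 * t := by
      rw [← mul_div_assoc, le_div_iff₀ hu]
      exact hlarge.le
    refine ⟨⌈484 * t ^ 2⌉₊, ?_, fun x hx => ?_⟩
    · nlinarith [Nat.ceil_lt_add_one (show 0 ≤ 484 * t ^ 2 by positivity)]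
    have hL : 484 * t ^ 2 ≤ ⌈484 * t ^ 2⌉₊ := Nat.le_ceil _
    obtain ⟨z, hz⟩ := exists_norm_map_sub_average_le hR' hW (by linarith) (le_max_right _ _)
      (hT x hx) (fun b y hy => hweak b y (hTphase x hx y hy))
      (show Λ ^ 2 ≤ (⌈484 * t ^ 2⌉₊ : ℕ) by nlinarith)
    refine ⟨z, fun b => (hz b).trans ?_⟩
    have hsqrt : 22 * t ≤ √(⌈484 * t ^ 2⌉₊ : ℝ) := Real.le_sqrt_of_sq_le (by linarith)
    calc 11 * R / √(⌈484 * t ^ 2⌉₊ : ℝ) ≤ 11 * R / (22 * t) := by gcongr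
      _ = u / 2 := by
        simp only [t]
        field_simp
        norm_num

theorem seminormCoveringNumber_le_rpow (hR : 0 ≤ R)
    (hW : ∀ b j, ‖W b (EuclideanSpace.single j 1)‖ ≤ R) (hT : ∀ x ∈ T, ∑ j, ‖x j‖ ≤ 1)
    (hTphase : ∀ x ∈ T, ∀ y : EuclideanSpace ℂ ι, (∀ j, ‖y j‖ = ‖x j‖) → y ∈ T)
    (hlog : ∀ b, ∀ x ∈ T, Real.log (Fintype.card β) * ‖W b x‖ ≤ 2 * R) {u : ℝ≥0} (hu : 0 < u) :
    (seminormCoveringNumber T (Finset.univ.sup fun b => (normSeminorm ℂ H).comp (W b)) u : ℝ≥0∞) ≤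
      ENNReal.ofReal ((2 * (Fintype.card ι : ℝ) + 1) ^ (1000 * (R / u) ^ 2)) := by
  obtain ⟨L, hL, hnet⟩ := exists_forall_mem_norm_map_sub_average_le hR hW hT hTphase hlog
    (NNReal.coe_pos.2 hu)
  have hcover := seminormCoveringNumber_le_card
    (p := Finset.univ.sup fun b => (normSeminorm ℂ H).comp (W b)) (u := u)
    (fun z : Fin L → Option (ι × Fin 4) => (L : ℝ)⁻¹ • ∑ i, l1Atom (z i)) fun x hx => by
      obtain ⟨z, hz⟩ := hnet x hx
      exact ⟨z, Seminorm.finset_sup_apply_le (by positivity) fun b _ => hz b⟩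
  have hcard : Fintype.card (Fin L → Option (ι × Fin 4)) = (4 * Fintype.card ι + 1) ^ L := by
    simp [mul_comm]
  rw [hcard] at hcover
  set d := Fintype.card ι
  calc _ ≤ (((4 * d + 1) ^ L : ℕ) : ℝ≥0∞) := mod_cast hcover
    _ = ENNReal.ofReal ((4 * d + 1 : ℝ) ^ L) := by
        rw [← ENNReal.ofReal_natCast]
        push_cast
        rfl
    _ ≤ _ := ENNReal.ofReal_le_ofReal ?_
  calc (4 * d + 1 : ℝ) ^ L ≤ ((2 * d + 1 : ℝ) ^ 2) ^ L := by
        gcongr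
        nlinarith [sq_nonneg (d : ℝ)]
    _ = (2 * d + 1 : ℝ) ^ ((2 * L : ℕ) : ℝ) := by rw [Real.rpow_natCast, pow_mul]
    _ ≤ (2 * d + 1 : ℝ) ^ (1000 * (R / u) ^ 2) := by
        apply Real.rpow_le_rpow_of_exponent_le (by simp)
        push_cast
        linarith

end CoveringNumber

section SparseVectors

theorem hammingNorm_congr_norm {ι : Type*} [Fintype ι] {E : ι → Type*}
    [∀ j, NormedAddCommGroup (E j)] [∀ j, DecidableEq (E j)] {x y : ∀ j, E j}
    (h : ∀ j, ‖y j‖ = ‖x j‖) : hammingNorm y = hammingNorm x := by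
  have hne (j : ι) : y j ≠ 0 ↔ x j ≠ 0 := by rw [← norm_ne_zero_iff, h j, norm_ne_zero_iff]
  simp only [hammingNorm, hne]

theorem sum_norm_le_sqrt_hammingNorm_mul_norm {ι 𝕜 : Type*} [Fintype ι] [RCLike 𝕜]
    [DecidableEq 𝕜] (x : EuclideanSpace 𝕜 ι) :
    ∑ j, ‖x j‖ ≤ √(hammingNorm (x.ofLp : ι → 𝕜)) * ‖x‖ := by
  calc ∑ j, ‖x j‖ = ∑ j with x j ≠ 0, 1 * ‖x j‖ := by
        simp only [one_mul]
        exact (Finset.sum_filter_of_ne fun j _ hj => by simpa using hj).symm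
    _ ≤ √(∑ j with x j ≠ 0, 1 ^ 2) * √(∑ j with x j ≠ 0, ‖x j‖ ^ 2) :=
        Real.sum_mul_le_sqrt_mul_sqrt _ _ _
    _ ≤ √(hammingNorm (x.ofLp : ι → 𝕜)) * ‖x‖ := by
        rw [EuclideanSpace.norm_eq]
        gcongr
        · simp [hammingNorm]
        · exact Finset.subset_univ _

variable {d k : ℕ} {x y : EuclideanSpace ℂ (Fin d)}

theorem mem_sparseBall_of_norm_eq (hx : x ∈ sparseBall d k) (h : ∀ j, ‖y j‖ = ‖x j‖) :
    y ∈ sparseBall d k := by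
  have hnorm : ‖y‖ = ‖x‖ := by simp only [EuclideanSpace.norm_eq, h]
  exact ⟨(hammingNorm_congr_norm h).trans_le hx.1, hnorm.trans_le hx.2⟩

theorem sum_norm_le_sqrt_of_mem_sparseBall (hx : x ∈ sparseBall d k) : ∑ j, ‖x j‖ ≤ √k :=
  calc ∑ j, ‖x j‖ ≤ √(hammingNorm (x.ofLp : Fin d → ℂ)) * ‖x‖ :=
        sum_norm_le_sqrt_hammingNorm_mul_norm x
    _ ≤ √k * 1 := by
        gcongr
        · exact hx.1
        · exact hx.2
    _ = √k := mul_one _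

theorem mem_scaledSparseBall_iff (hk : 0 < k) :
    x ∈ scaledSparseBall d k ↔ √k • x ∈ sparseBall d k := by
  have hk' : √(k : ℝ) ≠ 0 := by positivity
  exact Set.mem_image_iff_of_inverse (smul_inv_smul₀ hk') (inv_smul_smul₀ hk')

theorem mem_scaledSparseBall_of_norm_eq (hk : 0 < k) (hx : x ∈ scaledSparseBall d k)
    (h : ∀ j, ‖y j‖ = ‖x j‖) : y ∈ scaledSparseBall d k := by
  rw [mem_scaledSparseBall_iff hk] at hx ⊢
  exact mem_sparseBall_of_norm_eq hx fun j => by simp [h j]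

theorem sum_norm_le_one_of_mem_scaledSparseBall (hk : 0 < k) (hx : x ∈ scaledSparseBall d k) :
    ∑ j, ‖x j‖ ≤ 1 := by
  have hk' : 0 < √(k : ℝ) := by positivity
  have hsum := sum_norm_le_sqrt_of_mem_sparseBall ((mem_scaledSparseBall_iff hk).1 hx)
  simp only [PiLp.smul_apply, norm_smul, Real.norm_of_nonneg hk'.le, ← Finset.mul_sum] at hsum
  exact le_of_mul_le_mul_left (hsum.trans_eq (mul_one _).symm) hk'

end SparseVectors

section Buckets

variable {d m B k : ℕ} {A : Matrix (Fin (m * B)) (Fin d) ℂ}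

theorem norm_bucket_single_le (hA : ∀ i j, ‖A i j‖ ≤ 1) (b : Fin m) (j : Fin d) :
    ‖Matrix.toEuclideanLin (bucket A b) (EuclideanSpace.single j 1)‖ ≤ √B := by
  have hentry (i : Fin B) : (Matrix.toEuclideanLin (bucket A b) (EuclideanSpace.single j 1)) i =
      A (finProdFinEquiv (b, i)) j := by
    simp [Matrix.toLpLin_apply, bucket]
  rw [EuclideanSpace.norm_eq]
  apply Real.sqrt_le_sqrt
  calc _ ≤ ∑ _i : Fin B, (1 : ℝ) := by
        gcongr with i _
        rw [hentry]
        exact pow_le_one₀ (norm_nonneg _) (hA _ _)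
    _ = B := by simp

theorem log_mul_norm_bucket_le (hk : 0 < k) {Q₁ Q₂ : ℝ} {b : Fin m}
    (hAk : ∀ x ∈ sparseBall d k, ‖Matrix.toEuclideanLin (bucket A b) x‖ ≤ Q₁ * √B + Q₂ * √k)
    (hQB : Q₂ ^ 2 * Real.log m ^ 2 ≤ B) (hQk : Q₁ ^ 2 * Real.log m ^ 2 ≤ k)
    {x : EuclideanSpace ℂ (Fin d)} (hx : x ∈ scaledSparseBall d k) :
    Real.log m * ‖Matrix.toEuclideanLin (bucket A b) x‖ ≤ 2 * √B := by
  have hk' : 0 < √(k : ℝ) := by positivity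
  have hlog : 0 ≤ Real.log m := Real.log_natCast_nonneg m
  have hscaled := hAk _ ((mem_scaledSparseBall_iff hk).1 hx)
  rw [LinearMap.map_smul_of_tower, norm_smul, Real.norm_of_nonneg hk'.le] at hscaled
  have hQ₁ : Q₁ * Real.log m ≤ √k := Real.le_sqrt_of_sq_le (by rwa [mul_pow])
  have hQ₂ : Q₂ * Real.log m ≤ √B := Real.le_sqrt_of_sq_le (by rwa [mul_pow])
  refine le_of_mul_le_mul_left ?_ hk'
  calc √k * (Real.log m * ‖Matrix.toEuclideanLin (bucket A b) x‖)
      = Real.log m * (√k * ‖Matrix.toEuclideanLin (bucket A b) x‖) := by ring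
    _ ≤ Real.log m * (Q₁ * √B + Q₂ * √k) := mul_le_mul_of_nonneg_left hscaled hlog
    _ = (Q₁ * Real.log m) * √B + (Q₂ * Real.log m) * √k := by ring
    _ ≤ √k * √B + √B * √k := by gcongr
    _ = _ := by ring

end Buckets

theorem lemma6_general {d m B k : ℕ} (hk : 0 < k) {A : Matrix (Fin (m * B)) (Fin d) ℂ} {Q₁ Q₂ : ℝ}
    (hAk : ∀ b, ∀ x ∈ sparseBall d k,
      ‖Matrix.toEuclideanLin (bucket A b) x‖ ≤ Q₁ * √B + Q₂ * √k)
    (hA : ∀ i j, ‖A i j‖ ≤ 1) (hQB : Q₂ ^ 2 * Real.log m ^ 2 ≤ B)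
    (hQk : Q₁ ^ 2 * Real.log m ^ 2 ≤ k) {u : ℝ≥0} (hu : 0 < u) :
    (seminormCoveringNumber (scaledSparseBall d k) (xSeminorm A) u : ℝ≥0∞) ≤
      ENNReal.ofReal ((2 * (d : ℝ) + 1) ^ (1000 * ((B : ℝ) / (u : ℝ) ^ 2))) := by
  have hcover := seminormCoveringNumber_le_rpow (Real.sqrt_nonneg B) (T := scaledSparseBall d k)
    (W := fun b => Matrix.toEuclideanLin (bucket A b)) (norm_bucket_single_le hA)
    (fun x hx => sum_norm_le_one_of_mem_scaledSparseBall hk hx)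
    (fun x hx y hy => mem_scaledSparseBall_of_norm_eq hk hx hy)
    (fun b x hx => by
      simpa using log_mul_norm_bucket_le hk (hAk b) hQB hQk hx) hu
  rwa [Fintype.card_fin, div_pow, Real.sq_sqrt (Nat.cast_nonneg B)] at hcover

theorem lemma6 :
    ∃ C : ℝ, 0 < C ∧
      ∀ (d m B k : ℕ), 0 < m → 0 < B → 0 < k →
      ∀ (A : Matrix (Fin (m * B)) (Fin d) ℂ) (l : ℕ → ℝ) (Q₁ Q₂ : ℝ),
        GoodBuckets A k l →
        (∀ s : ℕ, 1 ≤ s → s ≤ 2 * k → l s ≤ Q₁ * Real.sqrt B + Q₂ * Real.sqrt s) →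
        (∀ i j, ‖A i j‖ ≤ 1) →
        max (Q₂ ^ 2 * Real.log m ^ 2) (Q₁ ^ 2 * Real.log m * Real.log k) ≤ (B : ℝ) →
        Q₁ ^ 2 * Real.log m ^ 2 ≤ (k : ℝ) →
        ∀ u : ℝ≥0, 0 < u →
          (seminormCoveringNumber (scaledSparseBall d k) (xSeminorm A) u : ℝ≥0∞) ≤
            ENNReal.ofReal ((2 * (d : ℝ) + 1) ^ (C * ((B : ℝ) / (u : ℝ) ^ 2))) := by
  refine ⟨1000, by norm_num, ?_⟩
  intro d m B k _ _ hk A l Q₁ Q₂ hgood hl hA hB hQk u hu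
  exact lemma6_general hk
    (fun b x hx => (hgood k hk (by lia) b x hx).trans (hl k hk (by lia))) hA
    ((le_max_left _ _).trans hB) hQk hu
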